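/- Let $A_1(\mathbb R)$ be the real Weyl algebra, generated over $\mathbb R$ by $x,y$ with $yx-xy=1$, let $\mathcal D_1(\mathbb R)$ be its quotient division ring, let $$R=\Big\{\sum_{k\ge m}a_kx^{-k/n}\ \Big|\ a_k\in\mathbb R,\ m\in\mathbb Z,\ n\in\mathbb N_{>0}\Big\},\qquad \delta=\frac{d}{dx},$$ and let $R[y;\delta]\supseteq A_1(\mathbb R)$ be the Ore extension with $ya=ay+\delta(a)$ for $a\in R$. A valuation on one of these rings takes values in a totally ordered group together with $\infty$, and is identified with its unique extension to the quotient division ring; "residue field $\mathbb R$" means that $\mathbb R$ lies in the valuation ring and maps bijectively onto the residue division ring. A bar denotes the residue. Let $v$ be a valuation on $A_1(\mathbb R)$ with residue field $\mathbb R$ and $v(x)<0$, normalized by $v(x)=-1$ (so that $v(a)=p/q$ means $q\,v(a)=p\,(-v(x))$). Let $(\omega_i)_{i\ge-1}$ in $\mathcal D_1(\mathbb R)$ be the sequence associated to $v$: $\omega_{-1}=x$, $\omega_0=y$, and, as long as $v(\omega_{i-1})$ ($i\ge1$) is rational, $v(\omega_{i-1})=m_i/n_i$ with $m_i,n_i$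 coprime integers, $n_i>0$, $\beta_i=\overline{x^{m_i}\omega_{i-1}^{n_i}}\in\mathbb R$ and $\omega_i=x^{m_i}\omega_{i-1}^{n_i}-\beta_i$. The sequence ends with $\omega_N$ if $v(\omega_N)$ is not rational, and is infinite ($N=\infty$) otherwise. Put $m_0=1$, $n_0=-1$. For indices $0\le i,j\le N$ (all $i,j\ge 0$ if $N=\infty$) put $$d_{i,j}=\gcd(m_jn_i,\,m_in_j),\qquad K_{i,j}=\frac{m_jn_i}{d_{i,j}},\qquad \alpha_{i,j}=\overline{\omega_{i-1}^{K_{i,j}}\,\omega_{j-1}^{-K_{j,i}}}\in\mathbb R$$ (with $\alpha_{i,i}=1$), and let $2^{h_i}$ be the greatest power of two dividing $n_i$. If $v$ extends to a valuation on $R[y;\delta]$ with residue field $\mathbb R$, then 1. $\beta_i>0$ for every index $i$ with $n_i$ even; 2. $\alpha_{i,j}\,\alpha_{i,\ell}>0$ for all indices $i,j,\ell$ with $h_i<h_j\le h_\ell$. -/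

import Mathlib

noncomputable section

open Polynomial
open scoped nonZeroDivisors

namespace Ore

/-- The Ore extension `C[y; δ]` of a commutative `ℝ`-algebra `C` by an `ℝ`-linear derivation `δ`: an
element `∑ aᵢ yⁱ` is stored as the polynomial of its left coefficients, and the multiplication,
defined below, is the one with `y a = a y + δ a`. -/
def Ext {C : Type*} [CommRing C] [Algebra ℝ C] (_δ : Derivation ℝ C C) : Type _ := C[X]

namespace Ext

variable {C : Type*} [CommRing C] [Algebra ℝ C] (δ : Derivation ℝ C C)

/-- Apply `δ` to every coefficient. -/
def coeffDeriv : C[X] →ₗ[ℝ] C[X] where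
  toFun p := p.sum fun i a => monomial i (δ a)
  map_add' p q := Polynomial.sum_add_index p q _ (by simp) (by simp)
  map_smul' r p := by
    have h := Polynomial.sum_smul_index p (algebraMap ℝ C r) (fun i a => monomial i (δ a)) (by simp)
    rw [algebraMap_smul] at h
    rw [h, RingHom.id_apply, Polynomial.sum_def, Polynomial.sum_def, Finset.smul_sum]
    refine Finset.sum_congr rfl fun i _ => ?_
    rw [← Algebra.smul_def, δ.map_smul, smul_monomial]

theorem coeffDeriv_monomial (i : ℕ) (a : C) :
    coeffDeriv δ (monomial i a) = monomial i (δ a) :=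
  Polynomial.sum_monomial_index (n := i) a (fun i a => monomial i (δ a)) (by simp)

theorem coeff_coeffDeriv (p : C[X]) (n : ℕ) : (coeffDeriv δ p).coeff n = δ (p.coeff n) := by
  induction p using Polynomial.induction_on' with
  | add p q hp hq => simp [hp, hq]
  | monomial i a =>
    rw [coeffDeriv_monomial, coeff_monomial, coeff_monomial]
    split_ifs <;> simp

/-- Left multiplication by a constant, as an operator on `C[X]`. -/
def opC : C →+* Module.End ℝ C[X] := (Algebra.lsmul ℝ ℝ C[X] : C →ₐ[ℝ] Module.End ℝ C[X]).toRingHom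

/-- Left multiplication by `y`, as an operator on `C[X]`: `y (∑ aᵢ yⁱ) = ∑ aᵢ yⁱ⁺¹ + ∑ δ(aᵢ) yⁱ`. -/
def opY : Module.End ℝ C[X] := LinearMap.mulLeft ℝ X + coeffDeriv δ

theorem opC_apply (a : C) (p : C[X]) : opC a p = a • p := rfl

theorem opY_apply (p : C[X]) : opY δ p = X * p + coeffDeriv δ p := rfl

theorem opY_opC (a : C) : opY δ * opC a = opC a * opY δ + opC (δ a) := by
  ext p n
  simp only [Module.End.mul_apply, LinearMap.add_apply, opC_apply, opY_apply, coeff_add,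
    coeff_coeffDeriv, coeff_smul, smul_eq_mul, Derivation.leibniz]
  cases n <;> simp [coeff_X_mul] <;> ring

/-- Left multiplication by `∑ aᵢ yⁱ`, as an operator on `C[X]`. -/
def op : C[X] →+ Module.End ℝ C[X] := eval₂AddMonoidHom opC (opY δ)

theorem op_monomial (i : ℕ) (a : C) : op δ (monomial i a) = opC a * opY δ ^ i :=
  eval₂_monomial _ _

theorem op_smul (a : C) (q : C[X]) : op δ (a • q) = opC a * op δ q := by
  induction q using Polynomial.induction_on' with
  | add p q hp hq => simp only [smul_add, map_add, hp, hq, mul_add]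
  | monomial i b => rw [smul_monomial, op_monomial, op_monomial, smul_eq_mul, map_mul, mul_assoc]

theorem op_opY (q : C[X]) : op δ (opY δ q) = opY δ * op δ q := by
  induction q using Polynomial.induction_on' with
  | add p q hp hq => simp only [map_add, hp, hq, mul_add]
  | monomial i b =>
    rw [opY_apply, coeffDeriv_monomial, X_mul_monomial, map_add, op_monomial, op_monomial,
      op_monomial, ← mul_assoc, opY_opC, add_mul, pow_succ', mul_assoc]

theorem op_op (p q : C[X]) : op δ (op δ p q) = op δ p * op δ q := by
  induction p using Polynomial.induction_on' with
  | add p p' hp hp' => simp only [map_add, LinearMap.add_apply, hp, hp', add_mul]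
  | monomial i a =>
    have h : ∀ i : ℕ, op δ ((opY δ ^ i) q) = opY δ ^ i * op δ q := by
      intro i
      induction i with
      | zero => simp
      | succ i ih => rw [pow_succ', Module.End.mul_apply, op_opY, ih, mul_assoc]
    rw [op_monomial, Module.End.mul_apply, opC_apply, op_smul, h, mul_assoc]

theorem opY_pow_one (i : ℕ) : (opY δ ^ i) 1 = (X : C[X]) ^ i := by
  induction i with
  | zero => simp
  | succ i ih =>
    rw [pow_succ', Module.End.mul_apply, ih, opY_apply, X_pow_eq_monomial, coeffDeriv_monomial]
    simp [X_mul_monomial, X_pow_eq_monomial]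

theorem op_apply_one (p : C[X]) : op δ p 1 = p := by
  induction p using Polynomial.induction_on' with
  | add p q hp hq => simp only [map_add, LinearMap.add_apply, hp, hq]
  | monomial i a =>
    rw [op_monomial, Module.End.mul_apply, opC_apply, opY_pow_one, X_pow_eq_monomial,
      smul_monomial, smul_eq_mul, mul_one]

theorem op_one : op δ (1 : C[X]) = 1 := by
  rw [← monomial_zero_one, op_monomial]; simp

instance : AddCommGroup (Ext δ) := inferInstanceAs (AddCommGroup C[X])

/-- The ring structure of `C[y; δ]`: `p * q` is the operator `p` applied to `q`; it is determined by
`C[y; δ] = ⨁ C yⁱ` and `y a = a y + δ a`. -/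
instance : Ring (Ext δ) where
  __ := (inferInstance : AddCommGroup (Ext δ))
  mul p q := op δ (p : C[X]) (q : C[X])
  one := (1 : C[X])
  left_distrib p q r := map_add (op δ p) q r
  right_distrib p q r := congrArg (fun f : Module.End ℝ C[X] => f r) (map_add (op δ) p q)
  zero_mul p := congrArg (fun f : Module.End ℝ C[X] => f p) (map_zero (op δ))
  mul_zero p := map_zero (op δ p)
  one_mul p := congrArg (fun f : Module.End ℝ C[X] => f p) (op_one δ)
  mul_one p := op_apply_one δ p
  mul_assoc p q r := congrArg (fun f : Module.End ℝ C[X] => f r) (op_op δ p q)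

/-- The polynomial of left coefficients of an element. -/
def toPoly : Ext δ ≃+ C[X] := AddEquiv.refl _

theorem toPoly_mul (p q : Ext δ) : toPoly δ (p * q) = op δ (toPoly δ p) (toPoly δ q) := rfl

theorem toPoly_one : toPoly δ 1 = 1 := rfl

/-- The inclusion of the coefficient ring. -/
def coeffHom : C →+* Ext δ where
  toFun a := (toPoly δ).symm (Polynomial.C a)
  map_zero' := by simp
  map_one' := by rw [Polynomial.C_1]; rfl
  map_add' a b := by simp
  map_mul' a b := (toPoly δ).injective (by
    rw [toPoly_mul, AddEquiv.apply_symm_apply, AddEquiv.apply_symm_apply,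
      AddEquiv.apply_symm_apply, ← monomial_zero_left (a := a), op_monomial]
    simp [opC_apply, Polynomial.smul_C])

/-- The variable `y`. -/
def y : Ext δ := (toPoly δ).symm X

theorem toPoly_coeffHom_mul (a : C) (p : Ext δ) :
    toPoly δ (coeffHom δ a * p) = a • toPoly δ p := by
  rw [toPoly_mul]
  change op δ (Polynomial.C a) _ = _
  rw [← monomial_zero_left (a := a), op_monomial]
  simp [opC_apply]

theorem toPoly_y_mul (p : Ext δ) :
    toPoly δ (y δ * p) = X * toPoly δ p + coeffDeriv δ (toPoly δ p) := by
  rw [toPoly_mul]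
  change op δ X _ = _
  rw [← monomial_one_one_eq_X, op_monomial, monomial_one_one_eq_X, ← opY_apply]
  simp

/-- The defining relation `y a = a y + δ a` -/
theorem y_mul_coeffHom (a : C) : y δ * coeffHom δ a = coeffHom δ a * y δ + coeffHom δ (δ a) := by
  apply (toPoly δ).injective
  rw [map_add, toPoly_coeffHom_mul, toPoly_y_mul]
  change X * Polynomial.C a + coeffDeriv δ (Polynomial.C a) = a • X + Polynomial.C (δ a)
  rw [← monomial_zero_left (a := a), coeffDeriv_monomial, X_mul_monomial, ← monomial_one_one_eq_X,
    smul_monomial]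
  simp

instance : Algebra ℝ (Ext δ) :=
  ((coeffHom δ).comp (algebraMap ℝ C)).toAlgebra' (by
    intro r p
    apply (toPoly δ).injective
    change toPoly δ (coeffHom δ (algebraMap ℝ C r) * p) = _
    rw [toPoly_coeffHom_mul, toPoly_mul]
    change _ = op δ (toPoly δ p) (Polynomial.C (algebraMap ℝ C r))
    induction toPoly δ p using Polynomial.induction_on' with
    | add p q hp hq => simp only [smul_add, map_add, LinearMap.add_apply, hp, hq]
    | monomial i a =>
      have h : ∀ i : ℕ, (opY δ ^ i) (Polynomial.C (algebraMap ℝ C r))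
          = monomial i (algebraMap ℝ C r) := by
        intro i
        induction i with
        | zero => simp
        | succ i ih =>
          rw [pow_succ', Module.End.mul_apply, ih, opY_apply, coeffDeriv_monomial]
          simp [X_mul_monomial]
      rw [op_monomial, Module.End.mul_apply, h, opC_apply, smul_monomial, smul_monomial,
        smul_eq_mul, smul_eq_mul, mul_comm])

theorem algebraMap_eq (r : ℝ) : algebraMap ℝ (Ext δ) r = coeffHom δ (algebraMap ℝ C r) := rfl

section Map

variable {δ} {C' : Type*} [CommRing C'] [Algebra ℝ C'] {δ' : Derivation ℝ C' C'}

/-- The ring homomorphism `C[y; δ] → C'[y; δ']`, `∑ aᵢ yⁱ ↦ ∑ f(aᵢ) yⁱ`. -/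
def map (f : C →+* C') (hf : ∀ a, f (δ a) = δ' (f a)) : Ext δ →+* Ext δ' where
  toFun p := (toPoly δ').symm ((toPoly δ p).map f)
  map_zero' := by simp
  map_one' := by rw [toPoly_one, Polynomial.map_one]; rfl
  map_add' p q := by simp
  map_mul' p q := by
    apply (toPoly δ').injective
    rw [toPoly_mul, toPoly_mul, AddEquiv.apply_symm_apply, AddEquiv.apply_symm_apply,
      AddEquiv.apply_symm_apply]
    have hY : ∀ (i : ℕ) (r : C[X]), ((opY δ ^ i) r).map f = (opY δ' ^ i) (r.map f) := by
      intro i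
      induction i with
      | zero => simp
      | succ i ih =>
        intro r
        rw [pow_succ, pow_succ, Module.End.mul_apply, Module.End.mul_apply, ih, opY_apply,
          opY_apply]
        congr 1
        ext n
        simp [coeff_coeffDeriv, hf]
    induction toPoly δ p using Polynomial.induction_on' with
    | add p p' hp hp' => simp only [map_add, LinearMap.add_apply, Polynomial.map_add, hp, hp']
    | monomial i a =>
      rw [op_monomial, Polynomial.map_monomial, op_monomial, Module.End.mul_apply,
        Module.End.mul_apply, opC_apply, opC_apply, Polynomial.map_smul, hY]

end Map

section Domain

theorem coeff_opY_pow (q : C[X]) (m : ℕ) (hq : q.natDegree ≤ m) (i : ℕ) :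
    ((opY δ ^ i) q).natDegree ≤ i + m ∧ ((opY δ ^ i) q).coeff (i + m) = q.coeff m := by
  induction i with
  | zero => simpa using hq
  | succ i ih =>
    rw [pow_succ', Module.End.mul_apply, opY_apply]
    set r := (opY δ ^ i) q
    have h0 : ∀ n, i + m < n → r.coeff n = 0 := fun n hn =>
      coeff_eq_zero_of_natDegree_lt (lt_of_le_of_lt ih.1 hn)
    refine ⟨natDegree_le_iff_coeff_eq_zero.2 fun n hn => ?_, ?_⟩
    · obtain ⟨n, rfl⟩ : ∃ k, n = k + 1 := ⟨n - 1, by omega⟩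
      rw [coeff_add, coeff_X_mul, coeff_coeffDeriv, h0 n (by omega), h0 (n + 1) (by omega)]
      simp
    · rw [show i + 1 + m = (i + m) + 1 by ring, coeff_add, coeff_X_mul, coeff_coeffDeriv,
        h0 (i + m + 1) (by omega), ih.2]
      simp

theorem op_degree (p q : C[X]) (k m : ℕ) (hp : p.natDegree ≤ k) (hq : q.natDegree ≤ m) :
    (op δ p q).natDegree ≤ k + m ∧ (op δ p q).coeff (k + m) = p.coeff k * q.coeff m := by
  have hs : op δ p q = ∑ i ∈ Finset.range (k + 1), p.coeff i • (opY δ ^ i) q := by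
    conv_lhs => rw [p.as_sum_range' (k + 1) (by omega)]
    rw [map_sum, LinearMap.sum_apply]
    refine Finset.sum_congr rfl fun i _ => ?_
    rw [op_monomial]; rfl
  have hi := coeff_opY_pow δ q m hq
  constructor
  · rw [hs]
    refine natDegree_sum_le_of_forall_le _ _ fun i hi' => ?_
    refine (natDegree_smul_le _ _).trans ((hi i).1.trans ?_)
    have := Finset.mem_range.1 hi'
    omega
  · rw [hs, finsetSum_coeff, Finset.sum_range_succ, Finset.sum_eq_zero, zero_add, coeff_smul,
      (hi k).2, smul_eq_mul]
    intro i hi'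
    have := Finset.mem_range.1 hi'
    rw [coeff_smul, coeff_eq_zero_of_natDegree_lt (lt_of_le_of_lt (hi i).1 (by omega)), smul_zero]

instance [Nontrivial C] : Nontrivial (Ext δ) := inferInstanceAs (Nontrivial C[X])

instance [IsDomain C] : NoZeroDivisors (Ext δ) where
  eq_zero_or_eq_zero_of_mul_eq_zero {p q} h := by
    by_contra! hne
    have h1 : toPoly δ p ≠ 0 := fun h => hne.1 ((toPoly δ).injective h)
    have h2 : toPoly δ q ≠ 0 := fun h => hne.2 ((toPoly δ).injective h)
    have h3 := (op_degree δ (toPoly δ p) (toPoly δ q) _ _ le_rfl le_rfl).2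
    rw [← toPoly_mul, h, map_zero, coeff_zero] at h3
    exact mul_ne_zero (leadingCoeff_ne_zero.2 h1) (leadingCoeff_ne_zero.2 h2) h3.symm

theorem exists_ore [IsDomain C] (r s : Ext δ) (hs : s ≠ 0) :
    ∃ s' r' : Ext δ, s' ≠ 0 ∧ s' * r = r' * s := by
  set k := max (toPoly δ r).natDegree (toPoly δ s).natDegree
  -- the left `C`-linear map `(u, w) ↦ u r - w s` on elements of degree at most `k`
  let V := Fin (k + 1) → C
  let P : V → C[X] := fun u => ∑ i : Fin (k + 1), monomial (i : ℕ) (u i)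
  have hPc : ∀ (u : V) (i : Fin (k + 1)), (P u).coeff i = u i := by
    intro u i
    simp [P, finsetSum_coeff, coeff_monomial, Fin.val_inj]
  have hPd : ∀ u : V, (P u).natDegree ≤ k := fun u =>
    natDegree_sum_le_of_forall_le _ _ fun i _ => (natDegree_monomial_le _).trans (by omega)
  have hPa : ∀ u w : V, P (u + w) = P u + P w := by
    intro u w
    simp only [P, V, Pi.add_apply, map_add, Finset.sum_add_distrib]
  have hPs : ∀ (a : C) (u : V), P (a • u) = a • P u := by
    intro a u
    simp only [P, V, Pi.smul_apply, Finset.smul_sum, smul_monomial]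
  let F : (Fin (k + 1) ⊕ Fin (k + 1) → C) →ₗ[C] (Fin (k + k + 1) → C) :=
    { toFun := fun g j => (op δ (P (g ∘ Sum.inl)) (toPoly δ r)
        - op δ (P (g ∘ Sum.inr)) (toPoly δ s)).coeff j
      map_add' := by
        intro g h; ext j
        have e1 : (g + h) ∘ Sum.inl = g ∘ Sum.inl + h ∘ Sum.inl := rfl
        have e2 : (g + h) ∘ Sum.inr = g ∘ Sum.inr + h ∘ Sum.inr := rfl
        simp only [e1, e2, hPa, map_add, LinearMap.add_apply, coeff_sub, coeff_add,
          Pi.add_apply]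
        ring
      map_smul' := by
        intro a g; ext j
        have e1 : (a • g) ∘ Sum.inl = a • (g ∘ Sum.inl) := rfl
        have e2 : (a • g) ∘ Sum.inr = a • (g ∘ Sum.inr) := rfl
        simp only [e1, e2, hPs, op_smul, Module.End.mul_apply, opC_apply, coeff_sub, coeff_smul,
          Pi.smul_apply, smul_eq_mul, RingHom.id_apply]
        ring }
  have hF : ¬ Function.Injective F := by
    intro hinj
    have := card_le_of_injective C F hinj
    simp at this
    omega
  rw [← LinearMap.ker_eq_bot, LinearMap.ker_eq_bot'] at hF
  push Not at hF
  obtain ⟨g, hg, hg0⟩ := hF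
  have hrel : op δ (P (g ∘ Sum.inl)) (toPoly δ r) = op δ (P (g ∘ Sum.inr)) (toPoly δ s) := by
    rw [← sub_eq_zero]
    ext n
    rw [coeff_zero]
    by_cases hn : n < k + k + 1
    · exact congrFun hg ⟨n, hn⟩
    · rw [coeff_sub, coeff_eq_zero_of_natDegree_lt
        (lt_of_le_of_lt (op_degree δ _ _ k k (hPd _) (le_max_left _ _)).1 (by omega)),
        coeff_eq_zero_of_natDegree_lt
        (lt_of_le_of_lt (op_degree δ _ _ k k (hPd _) (le_max_right _ _)).1 (by omega)), sub_zero]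
  have hmul : (toPoly δ).symm (P (g ∘ Sum.inl)) * r = (toPoly δ).symm (P (g ∘ Sum.inr)) * s := hrel
  refine ⟨_, _, fun h0 => hg0 ?_, hmul⟩
  rw [h0, zero_mul] at hmul
  have h1 : P (g ∘ Sum.inl) = 0 := (AddEquiv.map_eq_zero_iff (toPoly δ).symm).1 h0
  have h2 : P (g ∘ Sum.inr) = 0 := (AddEquiv.map_eq_zero_iff (toPoly δ).symm).1
    ((mul_eq_zero.1 hmul.symm).resolve_right hs)
  ext j
  rcases j with i | i
  · have := hPc (g ∘ Sum.inl) i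
    rw [h1, coeff_zero] at this
    exact this.symm
  · have := hPc (g ∘ Sum.inr) i
    rw [h2, coeff_zero] at this
    exact this.symm

instance [IsDomain C] : OreLocalization.OreSet (Ext δ)⁰ :=
  Classical.choice (OreLocalization.nonempty_oreSet_iff_of_noZeroDivisors.2 fun r s => by
    obtain ⟨s', r', h0, h⟩ := exists_ore δ r s (nonZeroDivisors.ne_zero s.2)
    exact ⟨r', ⟨s', mem_nonZeroDivisors_of_ne_zero h0⟩, h⟩)

end Domain

end Ext

namespace Puiseux

/-- The field of real Puiseux series in `x⁻¹`: the Hahn series `∑ a_q x^{-q}` whose exponents `q`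
lie in `(1/n) ℤ` for some `n > 0`; the coefficient at `q` is that of `x^{-q}`. -/
def ring : Subring (HahnSeries ℚ ℝ) where
  carrier := {f | ∃ n : ℕ, 0 < n ∧ ∀ q ∈ f.support, ∃ k : ℤ, q = k / n}
  zero_mem' := ⟨1, one_pos, by simp⟩
  one_mem' := ⟨1, one_pos, fun q hq => ⟨0, by
    have : q = 0 := by
      by_contra h
      exact hq (by rw [HahnSeries.coeff_one, if_neg h])
    simp [this]⟩⟩
  neg_mem' := by
    rintro f ⟨n, hn, h⟩
    exact ⟨n, hn, by simpa using h⟩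
  add_mem' := by
    rintro f g ⟨n, hn, hf⟩ ⟨m, hm, hg⟩
    refine ⟨n * m, Nat.mul_pos hn hm, fun q hq => ?_⟩
    have hn' : (n : ℚ) ≠ 0 := by positivity
    have hm' : (m : ℚ) ≠ 0 := by positivity
    rcases HahnSeries.support_add_subset _ _ hq with h | h
    · obtain ⟨k, rfl⟩ := hf q h
      exact ⟨k * m, by push_cast; field_simp⟩
    · obtain ⟨k, rfl⟩ := hg q h
      exact ⟨k * n, by push_cast; field_simp⟩
  mul_mem' := by
    rintro f g ⟨n, hn, hf⟩ ⟨m, hm, hg⟩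
    refine ⟨n * m, Nat.mul_pos hn hm, fun q hq => ?_⟩
    have hn' : (n : ℚ) ≠ 0 := by positivity
    have hm' : (m : ℚ) ≠ 0 := by positivity
    obtain ⟨a, ha, b, hb, rfl⟩ := HahnSeries.support_mul_subset hq
    obtain ⟨k, rfl⟩ := hf a ha
    obtain ⟨l, rfl⟩ := hg b hb
    exact ⟨k * m + l * n, by push_cast; field_simp⟩

theorem single_mem (q : ℚ) (a : ℝ) : HahnSeries.single q a ∈ ring :=
  ⟨q.den, q.den_pos, fun p hp => ⟨q.num, by
    have : p = q := by
      by_contra h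
      exact hp (HahnSeries.coeff_single_of_ne h)
    rw [this, Rat.num_div_den]⟩⟩

instance : Algebra ℝ ring :=
  ((HahnSeries.C : ℝ →+* HahnSeries ℚ ℝ).codRestrict ring (fun a => single_mem 0 a)).toAlgebra

theorem coe_algebraMap (r : ℝ) :
    ((algebraMap ℝ ring r : ring) : HahnSeries ℚ ℝ) = HahnSeries.C r := rfl

theorem coeff_smul (r : ℝ) (f : ring) (q : ℚ) :
    ((r • f : ring) : HahnSeries ℚ ℝ).coeff q = r * (f : HahnSeries ℚ ℝ).coeff q := by
  rw [Algebra.smul_def, Subring.coe_mul, coe_algebraMap, HahnSeries.C_mul_eq_smul]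
  rfl

/-- `x d/dx` on Hahn series: `x^{-q} ↦ -q x^{-q}`. -/
def euler (f : HahnSeries ℚ ℝ) : HahnSeries ℚ ℝ where
  coeff q := -(q : ℝ) * f.coeff q
  isPWO_support' := f.isPWO_support.mono fun q hq h => hq (by
    change -(q : ℝ) * f.coeff q = 0
    rw [h, mul_zero])

theorem coeff_euler (f : HahnSeries ℚ ℝ) (q : ℚ) : (euler f).coeff q = -(q : ℝ) * f.coeff q := rfl

theorem support_euler (f : HahnSeries ℚ ℝ) : (euler f).support ⊆ f.support := fun q hq h => hq (by
  rw [coeff_euler, h, mul_zero])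

theorem euler_mul (f g : HahnSeries ℚ ℝ) : euler (f * g) = f * euler g + g * euler f := by
  ext q
  rw [mul_comm g, HahnSeries.coeff_add, coeff_euler,
    HahnSeries.coeff_mul_left' f.isPWO_support (support_euler f),
    HahnSeries.coeff_mul_right' g.isPWO_support (support_euler g), HahnSeries.coeff_mul,
    Finset.mul_sum, ← Finset.sum_add_distrib]
  refine Finset.sum_congr rfl fun ij hij => ?_
  rw [Finset.mem_antidiagonal] at hij
  rw [coeff_euler, coeff_euler, ← hij.2.2]
  push_cast
  ring

theorem single_mul_euler_mem (f : ring) :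
    HahnSeries.single 1 1 * euler (f : HahnSeries ℚ ℝ) ∈ ring :=
  ring.mul_mem (single_mem 1 1) (by
    obtain ⟨n, hn, h⟩ := f.2
    exact ⟨n, hn, fun q hq => h q (support_euler _ hq)⟩)

/-- The derivation `δ = d/dx` on Puiseux series: `x^{-q} ↦ -q x^{-q-1}`. -/
def deriv : Derivation ℝ ring ring :=
  Derivation.mk'
    { toFun := fun f => ⟨HahnSeries.single 1 1 * euler (f : HahnSeries ℚ ℝ), single_mul_euler_mem f⟩
      map_add' := by
        intro f g
        apply Subtype.ext
        have : euler ((f + g : ring) : HahnSeries ℚ ℝ) = euler f + euler g := by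
          ext q
          simp only [coeff_euler, Subring.coe_add, HahnSeries.coeff_add]
          ring
        change HahnSeries.single 1 1 * euler ((f + g : ring) : HahnSeries ℚ ℝ)
          = HahnSeries.single 1 1 * euler f + HahnSeries.single 1 1 * euler g
        rw [this, mul_add]
      map_smul' := by
        intro r f
        apply Subtype.ext
        have : euler ((r • f : ring) : HahnSeries ℚ ℝ) = HahnSeries.C r * euler f := by
          ext q
          rw [coeff_euler, coeff_smul, HahnSeries.C_mul_eq_smul, HahnSeries.coeff_smul, coeff_euler,
            smul_eq_mul]
          ring
        change HahnSeries.single 1 1 * euler ((r • f : ring) : HahnSeries ℚ ℝ)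
          = HahnSeries.C r * (HahnSeries.single 1 1 * euler f)
        rw [this, mul_left_comm] }
    (by
      intro f g
      apply Subtype.ext
      change HahnSeries.single 1 1 * euler ((f : HahnSeries ℚ ℝ) * g)
        = (f : HahnSeries ℚ ℝ) * (HahnSeries.single 1 1 * euler g)
          + (g : HahnSeries ℚ ℝ) * (HahnSeries.single 1 1 * euler f)
      rw [euler_mul]
      ring)

theorem coeff_deriv (f : ring) (q : ℚ) :
    (deriv f : HahnSeries ℚ ℝ).coeff q = -((q : ℝ) - 1) * (f : HahnSeries ℚ ℝ).coeff (q - 1) := by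
  change (HahnSeries.single 1 1 * euler (f : HahnSeries ℚ ℝ)).coeff q = _
  rw [mul_comm, HahnSeries.coeff_mul_single, coeff_euler, mul_one]
  push_cast
  ring

/-- The element `x`. -/
def x : ring := ⟨HahnSeries.single (-1) 1, single_mem _ _⟩

theorem deriv_x : deriv x = 1 := by
  apply Subtype.ext
  ext q
  rw [coeff_deriv]
  change _ * (HahnSeries.single (-1) (1 : ℝ)).coeff (q - 1) = (1 : HahnSeries ℚ ℝ).coeff q
  rw [HahnSeries.coeff_one, HahnSeries.coeff_single]
  by_cases h : q = 0
  · subst h; norm_num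
  · rw [if_neg h, if_neg (fun h' => h (by linarith)), mul_zero]

end Puiseux

/-- The real Weyl algebra `A₁(ℝ) = ℝ[x][y; d/dx]`, in which `y x - x y = 1`. -/
abbrev Weyl : Type := Ext (Polynomial.derivative' : Derivation ℝ ℝ[X] ℝ[X])

namespace Weyl

/-- The generator `x`. -/
def x : Weyl := Ext.coeffHom _ X

/-- The generator `y`. -/
def y : Weyl := Ext.y _

theorem y_mul_x_sub : y * x - x * y = 1 := by
  rw [sub_eq_iff_eq_add, y, x, Ext.y_mul_coeffHom, add_comm]
  congr 1
  change Ext.coeffHom _ (derivative X) = 1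
  rw [derivative_X, map_one]

end Weyl

/-- The Ore extension `R[y; δ]` of the ring `R` of Puiseux series, `δ = d/dx`. -/
abbrev PuiseuxExt : Type := Ext Puiseux.deriv

/-- The inclusion `A₁(ℝ) → R[y; δ]`, `x ↦ x`, `y ↦ y`. -/
def incl : Weyl →+* PuiseuxExt :=
  Ext.map (Polynomial.aeval Puiseux.x : ℝ[X] →ₐ[ℝ] Puiseux.ring).toRingHom (by
    intro p
    change aeval Puiseux.x (derivative p) = Puiseux.deriv (aeval Puiseux.x p)
    rw [Derivation.map_aeval, Puiseux.deriv_x, smul_eq_mul, mul_one])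

theorem incl_y : incl Weyl.y = Ext.y _ :=
  (Ext.toPoly _).injective (Polynomial.map_X _)

theorem incl_x : incl Weyl.x = Ext.coeffHom _ Puiseux.x := by
  apply (Ext.toPoly _).injective
  change (Polynomial.C X).map _ = Polynomial.C Puiseux.x
  rw [Polynomial.map_C]
  congr 1
  exact aeval_X _

/-- The quotient division ring `{s⁻¹ a : s ≠ 0}` of an Ore domain. -/
abbrev Frac (A : Type*) [Ring A] [OreLocalization.OreSet A⁰] : Type _ := OreLocalization A⁰ A

/-- A valuation, with values in `Γ ∪ {∞}` for a totally ordered group `Γ`, not necessarily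
commutative and written additively. -/
structure Val (A : Type*) [Ring A] (Γ : Type*) [AddGroup Γ] [LinearOrder Γ] where
  /-- The underlying function. -/
  toFun : A → WithTop Γ
  eq_top_iff' : ∀ a, toFun a = ⊤ ↔ a = 0
  map_mul' : ∀ a b, toFun (a * b) = toFun a + toFun b
  map_add' : ∀ a b, min (toFun a) (toFun b) ≤ toFun (a + b)

namespace Val

variable {A : Type*} [Ring A] {Γ : Type*} [AddGroup Γ] [LinearOrder Γ]

instance : CoeFun (Val A Γ) (fun _ => A → WithTop Γ) := ⟨Val.toFun⟩

section Frac

variable [Nontrivial A] [NoZeroDivisors A] [OreLocalization.OreSet A⁰]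

/-- The value in `Γ` of a nonzero element. -/
def val (v : Val A Γ) (s : A⁰) : Γ :=
  (v s).untop fun h => nonZeroDivisors.ne_zero s.2 ((v.eq_top_iff' _).1 h)

theorem coe_val (v : Val A Γ) (s : A⁰) : (v.val s : WithTop Γ) = v s := WithTop.coe_untop _ _

/-- The extension of a valuation to the quotient division ring: `v(s⁻¹ a) = -v(s) + v(a)`. -/
def fracFun (v : Val A Γ) : Frac A → WithTop Γ :=
  OreLocalization.liftExpand (fun a s => ((-v.val s : Γ) : WithTop Γ) + v a) (by
    intro a t s hts
    have ht : t ≠ 0 := by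
      rintro rfl
      exact nonZeroDivisors.ne_zero hts (zero_mul _)
    have h : v.val ⟨t * s, hts⟩ = v.val ⟨t, mem_nonZeroDivisors_of_ne_zero ht⟩ + v.val s := by
      apply WithTop.coe_injective
      rw [WithTop.coe_add, coe_val, coe_val, coe_val, v.map_mul']
    rw [h, smul_eq_mul, v.map_mul', ← coe_val v ⟨t, mem_nonZeroDivisors_of_ne_zero ht⟩,
      ← add_assoc, ← WithTop.coe_add]
    simp)

theorem fracFun_oreDiv (v : Val A Γ) (a : A) (s : A⁰) :
    v.fracFun (OreLocalization.oreDiv a s) = ((-v.val s : Γ) : WithTop Γ) + v a := rfl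

theorem val_mul (v : Val A Γ) (t s : A⁰) : v.val (t * s) = v.val t + v.val s := by
  apply WithTop.coe_injective
  rw [WithTop.coe_add, coe_val, coe_val, coe_val, Submonoid.coe_mul, v.map_mul']

theorem fracFun_mul (v : Val A Γ) (z w : Frac A) :
    v.fracFun (z * w) = v.fracFun z + v.fracFun w := by
  induction z using OreLocalization.ind with | _ a s
  induction w using OreLocalization.ind with | _ b t
  obtain ⟨a', t', h⟩ := OreLocalization.oreCondition a t
  rw [OreLocalization.oreDiv_mul_char a b s t a' t' h]
  simp only [fracFun_oreDiv]
  have h1 : v a' = (v.val t' : WithTop Γ) + v a + ((-v.val t : Γ) : WithTop Γ) := by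
    rw [coe_val, ← v.map_mul', h, v.map_mul', ← coe_val v t, add_assoc, ← WithTop.coe_add]
    simp
  rw [v.map_mul', h1, val_mul, neg_add_rev, WithTop.coe_add]
  simp only [add_assoc]
  rw [← add_assoc (((-v.val t' : Γ)) : WithTop Γ) ((v.val t' : Γ) : WithTop Γ), ← WithTop.coe_add]
  simp

theorem fracFun_add [AddLeftMono Γ] (v : Val A Γ) (z w : Frac A) :
    min (v.fracFun z) (v.fracFun w) ≤ v.fracFun (z + w) := by
  induction z using OreLocalization.ind with | _ a s
  induction w using OreLocalization.ind with | _ b t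
  obtain ⟨r, u, h⟩ := OreLocalization.oreCondition (s : A) t
  have hus : (u : A) * s ∈ A⁰ := (u * s).2
  have hrt : r * (t : A) ∈ A⁰ := h ▸ hus
  rw [OreLocalization.oreDiv_add_char' s t r (u : A) h hus, OreLocalization.expand a s u hus,
    OreLocalization.expand b t r hrt]
  have e : (⟨r * t, hrt⟩ : A⁰) = ⟨u * s, hus⟩ := Subtype.ext h.symm
  rw [e]
  simp only [fracFun_oreDiv]
  have hv := v.map_add' ((u : A) • a) (r • b)
  rcases min_le_iff.1 hv with h' | h'
  · exact (min_le_left _ _).trans (add_le_add_right h' _)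
  · exact (min_le_right _ _).trans (add_le_add_right h' _)

/-- The unique extension of a valuation on an Ore domain to its quotient division ring. -/
def frac [AddLeftMono Γ] (v : Val A Γ) : Val (Frac A) Γ where
  toFun := v.fracFun
  eq_top_iff' z := by
    induction z using OreLocalization.ind with | _ a s
    rw [fracFun_oreDiv, WithTop.add_eq_top, v.eq_top_iff']
    constructor
    · rintro (h | rfl)
      · exact absurd h (WithTop.coe_ne_top)
      · exact OreLocalization.zero_oreDiv s
    · intro h
      rw [← OreLocalization.zero_oreDiv s, OreLocalization.oreDiv_eq_iff] at h
      obtain ⟨u, w, h1, h2⟩ := h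
      rw [smul_zero, smul_eq_mul] at h1
      have hw : w ≠ 0 := by
        rintro rfl
        rw [zero_mul] at h2
        exact nonZeroDivisors.ne_zero (u * s).2 h2
      exact Or.inr ((mul_eq_zero.1 h1.symm).resolve_left hw)
  map_mul' := v.fracFun_mul
  map_add' := v.fracFun_add

theorem frac_numerator [AddLeftMono Γ] (v : Val A Γ) (a : A) :
    v.frac (OreLocalization.numeratorHom a) = v a := by
  change ((-v.val 1 : Γ) : WithTop Γ) + v a = v a
  have h : v.val 1 = 0 := by
    have := val_mul v 1 1
    simpa using this
  rw [h]
  simp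

end Frac

section Extension

variable {B : Type*} [Ring B] {Γ' : Type*} [AddGroup Γ'] [LinearOrder Γ']

/-- The valuation `w` on `B` extends the valuation `v` on `A` along `f : A → B`, up to identification
of the values: `w ∘ f` and `v` order the elements of `A` in the same way. -/
def Extends (w : Val B Γ') (v : Val A Γ) (f : A →+* B) : Prop :=
  ∀ a b : A, w (f a) ≤ w (f b) ↔ v a ≤ v b

end Extension

section Residue

variable {D : Type*} [DivisionRing D] [Algebra ℝ D]

/-- `a` lies in the valuation ring and its residue is (the residue of) the real number `r`. -/
def HasResidue (v : Val D Γ) (a : D) (r : ℝ) : Prop :=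
  0 ≤ v a ∧ 0 < v (a - algebraMap ℝ D r)

/-- The residue field of `v` is `ℝ`: the real numbers lie in the valuation ring, and the induced map
from `ℝ` to the residue division ring is bijective. -/
def ResidueFieldReal (v : Val D Γ) : Prop :=
  (∀ r : ℝ, 0 ≤ v (algebraMap ℝ D r)) ∧ ∀ a : D, 0 ≤ v a → ∃! r : ℝ, v.HasResidue a r

/-- `v(a) = p / q` if the values are normalized by `v(x) = -1`; that is, `q v(a) = p e`, where
`e = -v(x)` plays the role of `1`. -/
def HasRatValue (v : Val D Γ) (x a : D) (p q : ℤ) : Prop :=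
  ∃ e g : Γ, v x = ((-e : Γ) : WithTop Γ) ∧ v a = (g : WithTop Γ) ∧ q • g = p • e

end Residue

end Val

/-- The quotient division ring `𝒟₁(ℝ)` of the real Weyl algebra. -/
abbrev WeylFrac : Type := Frac Weyl

namespace Weyl

/-- `x` as an element of `𝒟₁(ℝ)`. -/
def fx : WeylFrac := OreLocalization.numeratorHom x

/-- `y` as an element of `𝒟₁(ℝ)`. -/
def fy : WeylFrac := OreLocalization.numeratorHom y

/-- The sequence `ω₋₁ = x`, `ω₀ = y`, `ωᵢ = x^{mᵢ} ωᵢ₋₁^{nᵢ} - βᵢ` in `𝒟₁(ℝ)`, with the index shifted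
by one: `omega m n β i` is `ωᵢ₋₁`. -/
def omega (m n : ℕ → ℤ) (β : ℕ → ℝ) : ℕ → WeylFrac
  | 0 => fx
  | 1 => fy
  | i + 2 => fx ^ m (i + 1) * omega m n β (i + 1) ^ n (i + 1) - algebraMap ℝ WeylFrac (β (i + 1))

/-- The valuation `v` on `A₁(ℝ)`, normalized by `v(x) = -1`, is associated to the sequence
`(ωᵢ)` given by `mᵢ`, `nᵢ`, `βᵢ`: for `1 ≤ i ≤ N`, `v(ωᵢ₋₁) = mᵢ / nᵢ` in lowest terms and `βᵢ` is the
residue of `x^{mᵢ} ωᵢ₋₁^{nᵢ}`. If `N` is finite, then the sequence ends with `ω_N`, whose value is not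
rational; otherwise it is infinite. By convention `m₀ = 1` and `n₀ = -1`. -/
structure IsAssociated {Γ : Type*} [AddGroup Γ] [LinearOrder Γ] [AddLeftMono Γ]
    (v : Val Weyl Γ) (N : ℕ∞) (m n : ℕ → ℤ) (β : ℕ → ℝ) : Prop where
  x_neg : v x < 0
  m_zero : m 0 = 1
  n_zero : n 0 = -1
  n_pos : ∀ i : ℕ, 1 ≤ i → (i : ℕ∞) ≤ N → 0 < n i
  coprime : ∀ i : ℕ, 1 ≤ i → (i : ℕ∞) ≤ N → IsCoprime (m i) (n i)
  value : ∀ i : ℕ, 1 ≤ i → (i : ℕ∞) ≤ N → v.frac.HasRatValue fx (omega m n β i) (m i) (n i)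
  residue : ∀ i : ℕ, 1 ≤ i → (i : ℕ∞) ≤ N →
    v.frac.HasResidue (fx ^ m i * omega m n β i ^ n i) (β i)
  irrational : ∀ k : ℕ, N = (k : ℕ∞) →
    ∀ p q : ℤ, 0 < q → ¬ v.frac.HasRatValue fx (omega m n β (k + 1)) p q

/-- `K_{i,j} = m_j n_i / d_{i,j}` with `d_{i,j} = gcd (m_j n_i, m_i n_j)`; the division is exact. -/
def K (m n : ℕ → ℤ) (i j : ℕ) : ℤ := m j * n i / (Int.gcd (m j * n i) (m i * n j) : ℤ)

/-- `α_{i,j}` is the residue of `ωᵢ₋₁^{K_{i,j}} ωⱼ₋₁^{-K_{j,i}}`, for all indices `0 ≤ i, j ≤ N`. -/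
def IsAlpha {Γ : Type*} [AddGroup Γ] [LinearOrder Γ] [AddLeftMono Γ]
    (v : Val Weyl Γ) (N : ℕ∞) (m n : ℕ → ℤ) (β : ℕ → ℝ) (α : ℕ → ℕ → ℝ) : Prop :=
  ∀ i j : ℕ, (i : ℕ∞) ≤ N → (j : ℕ∞) ≤ N →
    v.frac.HasResidue (omega m n β i ^ K m n i j * omega m n β j ^ (-K m n j i)) (α i j)

/-- The exponent `hᵢ` of the greatest power of two that divides `nᵢ`. -/
def h (n : ℕ → ℤ) (i : ℕ) : ℕ := padicValInt 2 (n i)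

end Weyl

end Ore

end

/-!
Let `W` be the given valuation on the quotient division ring of `R[y; δ]`. The reason for both claims
is that `R` contains all roots `t = x^{1/M}`, so every element `a` whose value is a rational multiple
of `v(x)` can be written as `t ^ k` times a unit `u` of the valuation ring, for suitable `M`. The
residue of `u` is a nonzero real number, the *leading coefficient* of `a` with respect to `t`
(`Val.HasLead`). Conjugation by `t` does not change residues, because the residue field is `ℝ`, whose
elements are central; hence leading coefficients are multiplicative, although neither the ring nor
the value group is assumed commutative (`Val.HasLead.mul`, `Val.HasLead.zpow`). The leading
coefficient of `x` itself is `1`.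

If `rᵢ` is the leading coefficient of `ωᵢ₋₁`, then `βᵢ = rᵢ ^ nᵢ` and
`α i j = rᵢ ^ K i j * rⱼ ^ (-K j i)`. This gives the first claim. For the second, `hᵢ < hⱼ` makes
`K i j` odd and `K j i` even (`Weyl.odd_K`, `Weyl.even_K`), so that `α i j * α i l` is a product of
even powers of nonzero real numbers.

The residues are transported along the embedding of `𝒟₁(ℝ)` into the larger division ring, which
preserves and reflects the signs of values (`Val.Extends.nonneg_frac_iff`,
`Val.Extends.frac_nonpos_iff`).
-/

namespace Ore

open scoped nonZeroDivisors

namespace Val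

/-! ### Valuations on division rings and residues -/

section DivisionRing

variable {D : Type*} [DivisionRing D] {Γ : Type*} [AddGroup Γ] [LinearOrder Γ] (W : Val D Γ)

theorem map_ne_top {a : D} (ha : a ≠ 0) : W a ≠ ⊤ := fun h => ha ((W.eq_top_iff' a).1 h)

theorem exists_eq_coe {a : D} (ha : a ≠ 0) : ∃ g : Γ, W a = g :=
  ⟨(W a).untop (W.map_ne_top ha), (WithTop.coe_untop _ _).symm⟩

theorem map_one : W 1 = 0 := by
  obtain ⟨g, hg⟩ := W.exists_eq_coe (one_ne_zero (α := D))
  have h := W.map_mul' 1 1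
  rw [mul_one, hg, ← WithTop.coe_add, WithTop.coe_inj] at h
  rw [hg, left_eq_add.1 h, WithTop.coe_zero]

theorem map_inv {a : D} {g : Γ} (ha : W a = g) : W a⁻¹ = (-g : Γ) := by
  have ha0 : a ≠ 0 := by
    rintro rfl
    rw [(W.eq_top_iff' 0).2 rfl] at ha
    exact WithTop.coe_ne_top ha.symm
  obtain ⟨g', hg'⟩ := W.exists_eq_coe (inv_ne_zero ha0)
  have h := W.map_mul' a⁻¹ a
  rw [inv_mul_cancel₀ ha0, map_one, ha, hg', ← WithTop.coe_add, ← WithTop.coe_zero,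
    WithTop.coe_inj] at h
  rw [hg', eq_neg_of_add_eq_zero_left h.symm]

theorem map_zpow {a : D} {g : Γ} (ha : W a = g) (n : ℤ) : W (a ^ n) = (n • g : Γ) := by
  have hpow : ∀ k : ℕ, W (a ^ k) = (k • g : Γ) := by
    intro k
    induction k with
    | zero => simp [map_one]
    | succ k ih => rw [pow_succ, W.map_mul', ih, ha, succ_nsmul, WithTop.coe_add]
  obtain ⟨k, rfl | rfl⟩ := n.eq_nat_or_neg
  · simpa using hpow k
  · rw [zpow_neg, zpow_natCast, neg_zsmul, natCast_zsmul]
    exact W.map_inv (hpow k)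

theorem add_pos_of_pos {a b : D} (ha : 0 < W a) (hb : 0 < W b) : 0 < W (a + b) :=
  (lt_min ha hb).trans_le (W.map_add' a b)

theorem mul_pos_right [AddRightMono Γ] {a b : D} (ha : 0 ≤ W a) (hb : 0 < W b) : 0 < W (a * b) := by
  rw [W.map_mul']
  exact lt_of_lt_of_le hb (le_add_of_nonneg_left ha)

section Residue

variable {W} [Algebra ℝ D] {a : D} {r s : ℝ}

theorem HasResidue.unique (hW : W.ResidueFieldReal) (ha : W.HasResidue a r)
    (hb : W.HasResidue a s) : r = s :=
  (hW.2 a ha.1).unique ha hb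

theorem hasResidue_algebraMap (hW : W.ResidueFieldReal) (r : ℝ) :
    W.HasResidue (algebraMap ℝ D r) r :=
  ⟨hW.1 r, by rw [sub_self, (W.eq_top_iff' 0).2 rfl]; exact WithTop.coe_lt_top 0⟩

theorem hasResidue_zero_iff : W.HasResidue a 0 ↔ 0 < W a := by
  simp only [HasResidue, RingHom.map_zero, sub_zero, and_iff_right_iff_imp]
  exact le_of_lt

end Residue

variable [AddLeftMono Γ]

theorem inv_mul_nonneg_iff {u : D} (hu : u ≠ 0) (b : D) : 0 ≤ W (u⁻¹ * b) ↔ W u ≤ W b := by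
  obtain ⟨g, hg⟩ := W.exists_eq_coe hu
  rw [W.map_mul', W.map_inv hg, hg]
  induction W b with
  | top => simp
  | coe a => rw [← WithTop.coe_add, WithTop.coe_le_coe, ← WithTop.coe_zero, WithTop.coe_le_coe,
      le_neg_add_iff_add_le, add_zero]

theorem inv_mul_nonpos_iff {u : D} (hu : u ≠ 0) (b : D) : W (u⁻¹ * b) ≤ 0 ↔ W b ≤ W u := by
  obtain ⟨g, hg⟩ := W.exists_eq_coe hu
  rw [W.map_mul', W.map_inv hg, hg]
  induction W b with
  | top => simp
  | coe a => rw [← WithTop.coe_add, WithTop.coe_le_coe, ← WithTop.coe_zero, WithTop.coe_le_coe,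
      neg_add_le_iff_le_add, add_zero]

theorem mul_nonneg {a b : D} (ha : 0 ≤ W a) (hb : 0 ≤ W b) : 0 ≤ W (a * b) := by
  rw [W.map_mul']
  exact add_nonneg ha hb

theorem mul_pos_left {a b : D} (ha : 0 < W a) (hb : 0 ≤ W b) : 0 < W (a * b) := by
  rw [W.map_mul']
  exact lt_of_lt_of_le ha (le_add_of_nonneg_right hb)

variable [AddRightMono Γ]

theorem conj_nonneg {t a : D} (ht : t ≠ 0) (ha : 0 ≤ W a) : 0 ≤ W (t⁻¹ * a * t) := by
  have h : W (t⁻¹ * t) ≤ W (t⁻¹ * a * t) := by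
    rw [W.map_mul', W.map_mul' (t⁻¹ * a), W.map_mul']
    gcongr
    exact le_add_of_nonneg_right ha
  rwa [inv_mul_cancel₀ ht, map_one] at h

theorem conj_pos {t a : D} (ht : t ≠ 0) (ha : 0 < W a) : 0 < W (t⁻¹ * a * t) := by
  by_contra! h
  have h1 : W (t * (t⁻¹ * a * t) * t⁻¹) ≤ W (t * t⁻¹) := by
    rw [W.map_mul', W.map_mul' t, W.map_mul' t t⁻¹]
    gcongr
    exact add_le_of_nonpos_right h
  have h2 : t * (t⁻¹ * a * t) * t⁻¹ = a := by
    simp [mul_assoc, ht]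
  rw [h2, mul_inv_cancel₀ ht, map_one] at h1
  exact absurd ha h1.not_gt

section ResidueArithmetic

variable {W} [Algebra ℝ D] (hW : W.ResidueFieldReal) {a b t : D} {r s : ℝ}

/-- Real numbers are central, so conjugation acts trivially on residues. -/
theorem HasResidue.conj (ht : t ≠ 0) (ha : W.HasResidue a r) : W.HasResidue (t⁻¹ * a * t) r := by
  refine ⟨W.conj_nonneg ht ha.1, ?_⟩
  have h : t⁻¹ * a * t - algebraMap ℝ D r = t⁻¹ * (a - algebraMap ℝ D r) * t := by
    rw [mul_sub, sub_mul, mul_assoc t⁻¹ (algebraMap ℝ D r), Algebra.commutes r t,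
      inv_mul_cancel_left₀ ht]
  rw [h]
  exact W.conj_pos ht ha.2

include hW

theorem HasResidue.mul (ha : W.HasResidue a r) (hb : W.HasResidue b s) :
    W.HasResidue (a * b) (r * s) := by
  refine ⟨W.mul_nonneg ha.1 hb.1, ?_⟩
  have h : a * b - algebraMap ℝ D (r * s)
      = (a - algebraMap ℝ D r) * b + algebraMap ℝ D r * (b - algebraMap ℝ D s) := by
    rw [RingHom.map_mul]; noncomm_ring
  rw [h]
  exact W.add_pos_of_pos (W.mul_pos_left ha.2 hb.1) (W.mul_pos_right (hW.1 r) hb.2)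

omit [AddLeftMono Γ] [AddRightMono Γ] in
theorem HasResidue.map_eq_zero (hr : r ≠ 0) (ha : W.HasResidue a r) : W a = 0 := by
  refine le_antisymm (not_lt.1 fun h => hr ?_) ha.1
  exact ha.unique hW <| hasResidue_zero_iff.2 h

theorem HasResidue.inv (hr : r ≠ 0) (ha : W.HasResidue a r) : W.HasResidue a⁻¹ r⁻¹ := by
  have ha0 := ha.map_eq_zero hW hr
  have hne : a ≠ 0 := by
    rintro rfl
    rw [(W.eq_top_iff' 0).2 rfl] at ha0
    exact WithTop.top_ne_zero ha0
  have hinv : 0 ≤ W a⁻¹ := by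
    rw [W.map_inv (g := 0) (by simpa using ha0)]
    simp
  obtain ⟨s, hs, -⟩ := hW.2 _ hinv
  have h := ha.mul hW hs
  rw [mul_inv_cancel₀ hne, ← RingHom.map_one (algebraMap ℝ D)] at h
  rwa [inv_eq_of_mul_eq_one_right (h.unique hW (hasResidue_algebraMap hW 1))]

end ResidueArithmetic

end DivisionRing

/-! ### Leading coefficients -/

section Lead

variable {D : Type*} [DivisionRing D] [Algebra ℝ D] {Γ : Type*} [AddGroup Γ] [LinearOrder Γ]

/-- `a` is `t ^ k` times a unit of the valuation ring with residue `r`, a nonzero real number. -/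
def HasLead (W : Val D Γ) (t a : D) (k : ℤ) (r : ℝ) : Prop :=
  r ≠ 0 ∧ W.HasResidue (t ^ (-k) * a) r

theorem hasLead_self_zpow {W : Val D Γ} (hW : W.ResidueFieldReal) (t : D) (ht : t ≠ 0) (k : ℤ) :
    W.HasLead t (t ^ k) k 1 := by
  refine ⟨one_ne_zero, ?_⟩
  rw [zpow_neg, inv_mul_cancel₀ (zpow_ne_zero k ht), ← RingHom.map_one (algebraMap ℝ D)]
  exact hasResidue_algebraMap hW 1

variable [AddLeftMono Γ] [AddRightMono Γ] {W : Val D Γ} (hW : W.ResidueFieldReal)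
  {t a b : D} (ht : t ≠ 0) {k l : ℤ} {r s : ℝ}

include hW ht

theorem HasLead.mul (ha : W.HasLead t a k r) (hb : W.HasLead t b l s) :
    W.HasLead t (a * b) (k + l) (r * s) := by
  refine ⟨mul_ne_zero ha.1 hb.1, ?_⟩
  have h := (ha.2.conj (zpow_ne_zero l ht)).mul hW hb.2
  -- `t ^ (-k - l) * (a * b) = (t ^ (-l) * (t ^ (-k) * a) * t ^ l) * (t ^ (-l) * b)`
  convert h using 1
  rw [neg_add_rev, zpow_add₀ ht, zpow_neg t l]
  simp only [mul_assoc]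
  rw [mul_inv_cancel_left₀ (zpow_ne_zero l ht)]

theorem HasLead.inv (ha : W.HasLead t a k r) : W.HasLead t a⁻¹ (-k) r⁻¹ := by
  refine ⟨inv_ne_zero ha.1, ?_⟩
  -- `t ^ k * a⁻¹` is the inverse of the conjugate `t ^ k * (t ^ (-k) * a) * t ^ (-k)`
  convert (ha.2.conj (zpow_ne_zero (-k) ht)).inv hW ha.1 using 1
  rw [← mul_assoc, inv_mul_cancel₀ (zpow_ne_zero (-k) ht), one_mul, mul_inv_rev, zpow_neg t (-k)]

theorem HasLead.zpow (ha : W.HasLead t a k r) (n : ℤ) : W.HasLead t (a ^ n) (k * n) (r ^ n) := by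
  have hpow : ∀ n : ℕ, W.HasLead t (a ^ n) (k * n) (r ^ n) := by
    intro n
    induction n with
    | zero => simpa using hasLead_self_zpow hW t ht 0
    | succ n ih =>
      rw [pow_succ, pow_succ, Nat.cast_succ, mul_add_one]
      exact ih.mul hW ht ha
  obtain ⟨n, rfl | rfl⟩ := n.eq_nat_or_neg
  · simpa using hpow n
  · simpa using (hpow n).inv hW ht

omit ht in
/-- An element `a` with `v((t ^ M) ^ m * a ^ n) = 0` has a leading coefficient with respect to `t`
if `n` divides `M`: the value group is torsion-free. -/
theorem exists_hasLead {m n c : ℤ} (hn : n ≠ 0) (ht : t ≠ 0) (ha : a ≠ 0)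
    (h : W ((t ^ (n * c)) ^ m * a ^ n) = 0) : ∃ r, W.HasLead t a (-(m * c)) r := by
  obtain ⟨τ, hτ⟩ := W.exists_eq_coe ht
  obtain ⟨g, hg⟩ := W.exists_eq_coe ha
  rw [← zpow_mul, W.map_mul', W.map_zpow hτ, W.map_zpow hg, ← WithTop.coe_add, ← WithTop.coe_zero,
    WithTop.coe_inj] at h
  have hg' : g = -((m * c) • τ) := by
    refine zsmul_right_injective hn ?_
    change n • g = n • _
    rw [zsmul_neg, ← mul_zsmul, eq_neg_of_add_eq_zero_right h]
    congr 2
    ring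
  have h0 : W (t ^ (m * c) * a) = 0 := by
    rw [W.map_mul', W.map_zpow hτ, hg, hg', ← WithTop.coe_add, add_neg_cancel, WithTop.coe_zero]
  obtain ⟨r, hr, -⟩ := hW.2 _ h0.ge
  refine ⟨r, ?_, by rwa [neg_neg]⟩
  rintro rfl
  exact (hasResidue_zero_iff.1 hr).ne' h0

end Lead

/-! ### Extension of valuations to quotient division rings -/

section Transfer

variable {A B : Type*} [Ring A] [Ring B]
  {Γ Γ' : Type*} [AddGroup Γ] [LinearOrder Γ] [AddGroup Γ'] [LinearOrder Γ']
  {v : Val A Γ} {w : Val B Γ'} {f : A →+* B}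

/-- An element of the kernel has the same value as `0`, that is `∞`. -/
theorem Extends.injective (h : w.Extends v f) : Function.Injective f := by
  rw [injective_iff_map_eq_zero]
  intro a ha
  have h1 := (h 0 a).1 (by rw [map_zero, ha])
  rw [(v.eq_top_iff' 0).2 rfl, top_le_iff] at h1
  exact (v.eq_top_iff' a).1 h1

end Transfer

end Val

section FracMap

variable {A B : Type*} [Ring A] [Ring B]
  [Nontrivial A] [NoZeroDivisors A] [OreLocalization.OreSet A⁰]
  [Nontrivial B] [NoZeroDivisors B] [OreLocalization.OreSet B⁰]

omit [Nontrivial A] [NoZeroDivisors A] in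
theorem numerator_ne_zero {a : A} (ha : a ≠ 0) :
    (OreLocalization.numeratorHom a : Frac A) ≠ 0 := by
  intro h
  refine ha (OreLocalization.numeratorHom_inj (R := A) (S := A⁰)
    (fun _ hs => hs.1) ?_)
  rw [h]
  exact (map_zero (OreLocalization.numeratorRingHom (R := A) (S := A⁰))).symm

theorem oreDiv_eq_inv_mul (a : A) (s : A⁰) :
    (OreLocalization.oreDiv a s : Frac A)
      = (OreLocalization.numeratorHom (s : A))⁻¹ * OreLocalization.numeratorHom a := by
  rw [eq_inv_mul_iff_mul_eq₀ (numerator_ne_zero (nonZeroDivisors.ne_zero s.2)),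
    OreLocalization.numeratorHom_apply, OreLocalization.numeratorHom_apply,
    OreLocalization.mul_cancel]

/-- The extension of an injective ring homomorphism between Ore domains to the quotient division
rings. -/
noncomputable def fracMap (f : A →+* B) (hf : Function.Injective f) : Frac A →+* Frac B :=
  OreLocalization.universalHom ((OreLocalization.numeratorRingHom (R := B) (S := B⁰)).comp f)
    { toFun := fun s => Units.mk0 (OreLocalization.numeratorHom (f s))
        (numerator_ne_zero ((map_ne_zero_iff f hf).2 (nonZeroDivisors.ne_zero s.2)))
      map_one' := by ext; simp [OreLocalization.one_def]
      map_mul' := fun s t => by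
        ext
        simp only [Submonoid.coe_mul, map_mul, Units.val_mk0, Units.val_mul] }
    (fun _ => rfl)

omit [NoZeroDivisors A] in
theorem fracMap_numerator (f : A →+* B) (hf : Function.Injective f) (a : A) :
    fracMap f hf (OreLocalization.numeratorHom a) = OreLocalization.numeratorHom (f a) :=
  OreLocalization.universalHom_commutes _ _ _

theorem fracMap_algebraMap [Algebra ℝ A] [Algebra ℝ B] (f : A →+* B) (hf : Function.Injective f)
    (hfr : ∀ r : ℝ, f (algebraMap ℝ A r) = algebraMap ℝ B r) (r : ℝ) :
    fracMap f hf (algebraMap ℝ (Frac A) r) = algebraMap ℝ (Frac B) r := by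
  refine (fracMap_numerator f hf (algebraMap ℝ A r)).trans ?_
  rw [hfr]
  rfl

namespace Val

variable {Γ Γ' : Type*} [AddGroup Γ] [LinearOrder Γ] [AddLeftMono Γ]
  [AddGroup Γ'] [LinearOrder Γ'] [AddLeftMono Γ'] {v : Val A Γ} {w : Val B Γ'} {f : A →+* B}

theorem Extends.nonneg_frac_iff (h : w.Extends v f) (z : Frac A) :
    0 ≤ w.frac (fracMap f h.injective z) ↔ 0 ≤ v.frac z := by
  induction z using OreLocalization.ind with | _ a s
  have hs := nonZeroDivisors.ne_zero s.2
  rw [oreDiv_eq_inv_mul, map_mul, map_inv₀, fracMap_numerator, fracMap_numerator,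
    inv_mul_nonneg_iff _ (numerator_ne_zero hs), inv_mul_nonneg_iff _ (numerator_ne_zero
    ((map_ne_zero_iff f h.injective).2 hs)), frac_numerator, frac_numerator, frac_numerator,
    frac_numerator]
  exact h s a

theorem Extends.frac_nonpos_iff (h : w.Extends v f) (z : Frac A) :
    w.frac (fracMap f h.injective z) ≤ 0 ↔ v.frac z ≤ 0 := by
  induction z using OreLocalization.ind with | _ a s
  have hs := nonZeroDivisors.ne_zero s.2
  rw [oreDiv_eq_inv_mul, map_mul, map_inv₀, fracMap_numerator, fracMap_numerator,
    inv_mul_nonpos_iff _ (numerator_ne_zero hs), inv_mul_nonpos_iff _ (numerator_ne_zero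
    ((map_ne_zero_iff f h.injective).2 hs)), frac_numerator, frac_numerator, frac_numerator,
    frac_numerator]
  exact h a s

theorem Extends.frac_eq_zero (h : w.Extends v f) {z : Frac A} (hz : v.frac z = 0) :
    w.frac (fracMap f h.injective z) = 0 :=
  le_antisymm ((h.frac_nonpos_iff z).2 hz.le) ((h.nonneg_frac_iff z).2 hz.ge)

theorem Extends.hasResidue [Algebra ℝ A] [Algebra ℝ B] (h : w.Extends v f)
    (hfr : ∀ r : ℝ, f (algebraMap ℝ A r) = algebraMap ℝ B r) {z : Frac A} {r : ℝ}
    (hz : v.frac.HasResidue z r) : w.frac.HasResidue (fracMap f h.injective z) r := by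
  refine ⟨(h.nonneg_frac_iff z).2 hz.1, ?_⟩
  rw [← fracMap_algebraMap f h.injective hfr, ← map_sub, ← not_le, h.frac_nonpos_iff, not_le]
  exact hz.2

end Val

end FracMap

/-! ### Roots of `x` -/

theorem incl_algebraMap (r : ℝ) :
    incl (algebraMap ℝ Weyl r) = algebraMap ℝ PuiseuxExt r := by
  apply (Ext.toPoly _).injective
  change (Polynomial.C (algebraMap ℝ (Polynomial ℝ) r)).map _
    = Polynomial.C (algebraMap ℝ Puiseux.ring r)
  rw [Polynomial.map_C]
  congr 1
  exact AlgHom.commutes (Polynomial.aeval Puiseux.x) r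

/-- The element `x ^ (1 / M)`, for a nonzero integer `M`, possibly negative, of the quotient
division ring of `R[y; δ]`. -/
noncomputable def xRoot (M : ℤ) : Frac PuiseuxExt :=
  OreLocalization.numeratorHom (Ext.coeffHom Puiseux.deriv
    (⟨HahnSeries.single (-1 / M : ℚ) 1, Puiseux.single_mem _ _⟩ : Puiseux.ring))

theorem coeffHom_injective {C : Type*} [CommRing C] [Algebra ℝ C] (δ : Derivation ℝ C C) :
    Function.Injective (Ext.coeffHom δ) := fun _ _ h =>
  Polynomial.C_injective ((Ext.toPoly δ).symm.injective h)

theorem xRoot_ne_zero (M : ℤ) : xRoot M ≠ 0 := by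
  refine numerator_ne_zero ((map_ne_zero_iff _ (coeffHom_injective _)).2 fun h => ?_)
  exact HahnSeries.single_ne_zero one_ne_zero (congrArg Subtype.val h)

theorem xRoot_zpow {M : ℤ} (hM : M ≠ 0) :
    xRoot M ^ M = OreLocalization.numeratorHom (Ext.coeffHom Puiseux.deriv Puiseux.x) := by
  have key : ∀ (M : ℤ) (k : ℕ), xRoot M ^ k = OreLocalization.numeratorHom
      (Ext.coeffHom Puiseux.deriv
        (⟨HahnSeries.single (k * (-1 / M) : ℚ) 1, Puiseux.single_mem _ _⟩ : Puiseux.ring)) := by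
    intro M k
    rw [xRoot, ← map_pow, ← map_pow]
    congr 2
    apply Subtype.ext
    simp [HahnSeries.single_pow]
  obtain ⟨k, rfl | rfl⟩ := M.eq_nat_or_neg
  · have hk : (k : ℚ) ≠ 0 := by exact_mod_cast hM
    rw [zpow_natCast, key]
    congr 2
    apply Subtype.ext
    change HahnSeries.single _ (1 : ℝ) = HahnSeries.single (-1) 1
    congr 1
    push_cast
    field_simp
  · have hk : (k : ℚ) ≠ 0 := by
      intro h; apply hM; have : k = 0 := by exact_mod_cast h
      simp [this]
    rw [zpow_neg, zpow_natCast, inv_eq_iff_eq_inv, key]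
    refine eq_inv_of_mul_eq_one_left ?_
    rw [← map_mul, ← map_mul]
    convert map_one (OreLocalization.numeratorHom (R := PuiseuxExt) (S := PuiseuxExt⁰))
    convert map_one (Ext.coeffHom Puiseux.deriv)
    apply Subtype.ext
    change HahnSeries.single _ (1 : ℝ) * HahnSeries.single (-1) 1 = 1
    rw [HahnSeries.single_mul_single, mul_one, ← HahnSeries.single_zero_one]
    congr 1
    push_cast
    rw [neg_div_neg_eq, mul_one_div_cancel hk, add_neg_cancel]

namespace Weyl

/-! ### Parity of the exponents `K` -/

section Arithmetic

variable {m n : ℕ → ℤ} {i j : ℕ}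

theorem two_pow_h_dvd (n : ℕ → ℤ) (i : ℕ) : (2 : ℤ) ^ h n i ∣ n i := by
  have := padicValInt_dvd (p := 2) (n i)
  exact_mod_cast this

theorem not_two_pow_h_succ_dvd (hi : n i ≠ 0) : ¬ (2 : ℤ) ^ (h n i + 1) ∣ n i := by
  have := padicValInt_dvd_iff (p := 2) (h n i + 1) (n i)
  intro hd
  rcases this.1 (by exact_mod_cast hd) with h1 | h1
  · exact hi h1
  · exact absurd h1 (by simp [h])

theorem not_two_pow_dvd_mul (hi : n i ≠ 0) (hc : IsCoprime (m j) (n j)) (hij : h n i < h n j) :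
    ¬ (2 : ℤ) ^ (h n i + 1) ∣ m j * n i := by
  intro hd
  have h2 : (2 : ℤ) ∣ n j := (dvd_pow_self 2 (by omega)).trans (two_pow_h_dvd n j)
  have hcop : IsCoprime ((2 : ℤ) ^ (h n i + 1)) (m j) :=
    (IsCoprime.of_isCoprime_of_dvd_right hc h2).symm.pow_left
  exact not_two_pow_h_succ_dvd hi (hcop.dvd_of_dvd_mul_left hd)

theorem two_pow_dvd_gcd (hij : h n i < h n j) :
    (2 : ℤ) ^ h n i ∣ (Int.gcd (m j * n i) (m i * n j) : ℤ) :=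
  Int.dvd_coe_gcd ((two_pow_h_dvd n i).mul_left _)
    (((pow_dvd_pow 2 hij.le).trans (two_pow_h_dvd n j)).mul_left _)

theorem gcd_mul_K (m n : ℕ → ℤ) (i j : ℕ) :
    (Int.gcd (m j * n i) (m i * n j) : ℤ) * K m n i j = m j * n i :=
  Int.mul_ediv_cancel' (Int.gcd_dvd_left _ _)

theorem gcd_mul_K_swap (m n : ℕ → ℤ) (i j : ℕ) :
    (Int.gcd (m j * n i) (m i * n j) : ℤ) * K m n j i = m i * n j := by
  rw [Int.gcd_comm]
  exact gcd_mul_K m n j i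

/-- `2 ^ hᵢ` is the exact power of two in `mⱼ nᵢ`, and it divides the gcd. -/
theorem odd_K (hi : n i ≠ 0) (hc : IsCoprime (m j) (n j)) (hij : h n i < h n j) :
    Odd (K m n i j) := by
  rw [← Int.not_even_iff_odd, even_iff_two_dvd]
  intro h2
  apply not_two_pow_dvd_mul hi hc hij
  rw [← gcd_mul_K m n i j, pow_succ]
  exact mul_dvd_mul (two_pow_dvd_gcd hij) h2

/-- The gcd divides `mⱼ nᵢ`, hence is not divisible by `2 ^ (hᵢ + 1)`, whereas `mᵢ nⱼ` is. -/
theorem even_K (hi : n i ≠ 0) (hc : IsCoprime (m j) (n j)) (hij : h n i < h n j) :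
    Even (K m n j i) := by
  obtain ⟨g, hg⟩ := two_pow_dvd_gcd (m := m) hij
  have hg2 : ¬ (2 : ℤ) ∣ g := by
    intro h2
    apply not_two_pow_dvd_mul hi hc hij
    rw [← gcd_mul_K m n i j, hg, pow_succ]
    exact (mul_dvd_mul_left _ h2).mul_right _
  have hd : (2 : ℤ) ^ (h n i + 1) ∣ 2 ^ h n i * (g * K m n j i) := by
    rw [← mul_assoc, ← hg, gcd_mul_K_swap]
    exact ((pow_dvd_pow 2 hij).trans (two_pow_h_dvd n j)).mul_left _
  rw [pow_succ] at hd
  have := (mul_dvd_mul_iff_left (by positivity)).1 hd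
  exact even_iff_two_dvd.2 ((Int.prime_two.dvd_or_dvd this).resolve_left hg2)

/-- The exponent of `t = x ^ (1 / M)` in `ωᵢ₋₁ ^ K i j * ωⱼ₋₁ ^ (-K j i)` vanishes, where
`k = -mᵢ M / nᵢ` and `l = -mⱼ M / nⱼ` are the exponents of `t` in `ωᵢ₋₁` and `ωⱼ₋₁`. -/
theorem lead_exponent_eq_zero {M k l : ℤ} (hg : m j * n i ≠ 0)
    (hk : n i * k = -(m i * M)) (hl : n j * l = -(m j * M)) :
    k * K m n i j + l * -K m n j i = 0 := by
  have hg0 : (Int.gcd (m j * n i) (m i * n j) : ℤ) ≠ 0 := by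
    intro h0
    have := gcd_mul_K m n i j
    rw [h0, zero_mul] at this
    exact hg this.symm
  refine (mul_eq_zero.1 ?_).resolve_left hg0
  linear_combination k * gcd_mul_K m n i j - l * gcd_mul_K_swap m n i j + m j * hk - m i * hl

end Arithmetic

/-! ### Signs of the residues `β` and `α` -/

theorem fracMap_fx {M : ℤ} (hM : M ≠ 0) (h : Function.Injective incl) :
    fracMap incl h fx = xRoot M ^ M := by
  rw [xRoot_zpow hM, ← incl_x]
  exact fracMap_numerator _ _ _

section Associated

variable {Γ : Type*} [AddGroup Γ] [LinearOrder Γ] [AddLeftMono Γ]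
  {v : Val Weyl Γ} {N : ℕ∞} {m n : ℕ → ℤ} {β : ℕ → ℝ}

theorem IsAssociated.n_ne_zero (hω : IsAssociated v N m n β) {i : ℕ} (hi : (i : ℕ∞) ≤ N) :
    n i ≠ 0 := by
  rcases Nat.eq_zero_or_pos i with rfl | h0
  · rw [hω.n_zero]; decide
  · exact (hω.n_pos i h0 hi).ne'

/-- This includes the index `0`, where `x ^ m₀ * ω₋₁ ^ n₀ = 1` by the convention on `m₀`, `n₀`. -/
theorem IsAssociated.balanced (hω : IsAssociated v N m n β) {i : ℕ} (hi : (i : ℕ∞) ≤ N) :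
    omega m n β i ≠ 0 ∧ v.frac (fx ^ m i * omega m n β i ^ n i) = 0 := by
  rcases Nat.eq_zero_or_pos i with rfl | h0
  · have hx : fx ≠ 0 := by
      refine numerator_ne_zero fun h => ?_
      have := hω.x_neg
      rw [(v.eq_top_iff' _).2 h] at this
      exact not_top_lt this
    refine ⟨hx, ?_⟩
    rw [hω.m_zero, hω.n_zero]
    change v.frac (fx ^ (1 : ℤ) * fx ^ (-1 : ℤ)) = 0
    rw [zpow_one, zpow_neg_one, mul_inv_cancel₀ hx, Val.map_one]
  · obtain ⟨e, g, he, hg, heg⟩ := hω.value i h0 hi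
    refine ⟨fun h => ?_, ?_⟩
    · rw [h, (v.frac.eq_top_iff' 0).2 rfl] at hg
      exact WithTop.coe_ne_top hg.symm
    · rw [v.frac.map_mul', v.frac.map_zpow he, v.frac.map_zpow hg, heg, zsmul_neg,
        ← WithTop.coe_add, neg_add_cancel, WithTop.coe_zero]

variable {Γ' : Type*} [AddGroup Γ'] [LinearOrder Γ'] [AddLeftMono Γ'] [AddRightMono Γ']
  {w : Val PuiseuxExt Γ'}

theorem IsAssociated.exists_hasLead (hω : IsAssociated v N m n β) (hw : w.frac.ResidueFieldReal)
    (hwv : w.Extends v incl) {M : ℤ} (hM : M ≠ 0) {i : ℕ} (hi : (i : ℕ∞) ≤ N) (hn : n i ∣ M) :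
    ∃ (k : ℤ) (r : ℝ), n i * k = -(m i * M) ∧
      w.frac.HasLead (xRoot M) (fracMap incl hwv.injective (omega m n β i)) k r := by
  obtain ⟨c, hc⟩ := hn
  obtain ⟨h0, h1⟩ := hω.balanced hi
  have h2 := hwv.frac_eq_zero h1
  rw [map_mul, map_zpow₀, map_zpow₀, fracMap_fx hM hwv.injective] at h2
  nth_rw 2 [hc] at h2
  obtain ⟨r, hr⟩ := Val.exists_hasLead hw (hω.n_ne_zero hi) (xRoot_ne_zero M)
    ((map_ne_zero _).2 h0) h2
  exact ⟨_, r, by rw [hc]; ring, hr⟩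

theorem IsAssociated.beta_pos (hω : IsAssociated v N m n β) (hw : w.frac.ResidueFieldReal)
    (hwv : w.Extends v incl) {i : ℕ} (hi : (i : ℕ∞) ≤ N) (he : Even (n i)) : 0 < β i := by
  have h1 : 1 ≤ i := by
    by_contra! h0
    obtain rfl : i = 0 := by omega
    rw [hω.n_zero] at he
    exact absurd he (by decide)
  have hM := hω.n_ne_zero hi
  have ht := xRoot_ne_zero (n i)
  obtain ⟨k, r, hk, hr⟩ := hω.exists_hasLead hw hwv hM hi dvd_rfl
  have hβ := hwv.hasResidue incl_algebraMap (hω.residue i h1 hi)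
  rw [map_mul, map_zpow₀, map_zpow₀, fracMap_fx hM hwv.injective] at hβ
  have hl := ((Val.hasLead_self_zpow hw _ ht (n i)).zpow hw ht (m i)).mul hw ht
    (hr.zpow hw ht (n i))
  rw [show n i * m i + k * n i = 0 by linear_combination hk] at hl
  have hl2 := hl.2
  rw [neg_zero, zpow_zero, one_mul, one_zpow, one_mul] at hl2
  rw [hβ.unique hw hl2]
  exact he.zpow_pos hr.1

theorem IsAssociated.alpha_eq (hω : IsAssociated v N m n β) (hw : w.frac.ResidueFieldReal)
    (hwv : w.Extends v incl) {α : ℕ → ℕ → ℝ} (hα : IsAlpha v N m n β α)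
    {i j : ℕ} (hi : (i : ℕ∞) ≤ N) (hj : (j : ℕ∞) ≤ N) (hmj : m j ≠ 0) {M k l : ℤ} {r s : ℝ}
    (hk : n i * k = -(m i * M)) (hl : n j * l = -(m j * M))
    (hr : w.frac.HasLead (xRoot M) (fracMap incl hwv.injective (omega m n β i)) k r)
    (hs : w.frac.HasLead (xRoot M) (fracMap incl hwv.injective (omega m n β j)) l s) :
    α i j = r ^ K m n i j * s ^ (-K m n j i) := by
  have ht := xRoot_ne_zero M
  have h := hwv.hasResidue incl_algebraMap (hα i j hi hj)
  rw [map_mul, map_zpow₀, map_zpow₀] at h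
  have h2 := ((hr.zpow hw ht (K m n i j)).mul hw ht (hs.zpow hw ht (-K m n j i))).2
  rw [lead_exponent_eq_zero (mul_ne_zero hmj (hω.n_ne_zero hi)) hk hl, neg_zero, zpow_zero,
    one_mul] at h2
  exact h.unique hw h2

theorem IsAssociated.isCoprime (hω : IsAssociated v N m n β) {j : ℕ} (hj : (j : ℕ∞) ≤ N) :
    IsCoprime (m j) (n j) := by
  rcases Nat.eq_zero_or_pos j with rfl | h0
  · rw [hω.m_zero]; exact isCoprime_one_left
  · exact hω.coprime j h0 hj

/-- If `mⱼ = 0`, then `nⱼ` is a unit by coprimality. -/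
theorem ne_zero_of_isCoprime {j : ℕ} (hc : IsCoprime (m j) (n j)) (hj : 0 < h n j) : m j ≠ 0 := by
  intro h0
  rw [h0, isCoprime_zero_left] at hc
  have h2 : (2 : ℤ) ∣ n j := (dvd_pow_self 2 hj.ne').trans (two_pow_h_dvd n j)
  exact Int.prime_two.not_isUnit (isUnit_of_dvd_unit h2 hc)

theorem IsAssociated.alpha_mul_alpha_pos (hω : IsAssociated v N m n β)
    (hw : w.frac.ResidueFieldReal) (hwv : w.Extends v incl) {α : ℕ → ℕ → ℝ}
    (hα : IsAlpha v N m n β α) {i j l : ℕ} (hi : (i : ℕ∞) ≤ N) (hj : (j : ℕ∞) ≤ N)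
    (hl : (l : ℕ∞) ≤ N) (hij : h n i < h n j) (hil : h n i < h n l) : 0 < α i j * α i l := by
  have hni := hω.n_ne_zero hi
  have hcj := hω.isCoprime hj
  have hcl := hω.isCoprime hl
  have hmj := ne_zero_of_isCoprime hcj (by omega)
  have hml := ne_zero_of_isCoprime hcl (by omega)
  -- a common multiple, so that all three elements have leading coefficients for the same root
  have hM : n i * n j * n l ≠ 0 :=
    mul_ne_zero (mul_ne_zero hni (hω.n_ne_zero hj)) (hω.n_ne_zero hl)
  obtain ⟨ki, ri, hki, hri⟩ := hω.exists_hasLead hw hwv hM hi ⟨n j * n l, by ring⟩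
  obtain ⟨kj, rj, hkj, hrj⟩ := hω.exists_hasLead hw hwv hM hj ⟨n i * n l, by ring⟩
  obtain ⟨kl, rl, hkl, hrl⟩ := hω.exists_hasLead hw hwv hM hl ⟨n i * n j, by ring⟩
  rw [hω.alpha_eq hw hwv hα hi hj hmj hki hkj hri hrj,
    hω.alpha_eq hw hwv hα hi hl hml hki hkl hri hrl, mul_mul_mul_comm, ← zpow_add₀ hri.1]
  exact mul_pos (((odd_K hni hcj hij).add_odd (odd_K hni hcl hil)).zpow_pos hri.1)
    (mul_pos ((even_K hni hcj hij).neg.zpow_pos hrj.1) ((even_K hni hcl hil).neg.zpow_pos hrl.1))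

end Associated

end Weyl

end Ore

theorem mainTheorem4 {Γ Γ' : Type*}
    [AddGroup Γ] [LinearOrder Γ] [AddLeftMono Γ] [AddRightMono Γ]
    [AddGroup Γ'] [LinearOrder Γ'] [AddLeftMono Γ'] [AddRightMono Γ']
    -- a valuation on the real Weyl algebra with residue field `ℝ` and its sequence
    (v : Ore.Val Ore.Weyl Γ) (hv : v.frac.ResidueFieldReal)
    (N : ℕ∞) (m n : ℕ → ℤ) (β : ℕ → ℝ) (hω : Ore.Weyl.IsAssociated v N m n β)
    (α : ℕ → ℕ → ℝ) (hα : Ore.Weyl.IsAlpha v N m n β α)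
    -- an extension to `R[y; δ]` with residue field `ℝ`
    (w : Ore.Val Ore.PuiseuxExt Γ') (hw : w.frac.ResidueFieldReal)
    (hwv : w.Extends v Ore.incl) :
    (∀ i : ℕ, (i : ℕ∞) ≤ N → Even (n i) → 0 < β i) ∧
    (∀ i j l : ℕ, (i : ℕ∞) ≤ N → (j : ℕ∞) ≤ N → (l : ℕ∞) ≤ N →
      Ore.Weyl.h n i < Ore.Weyl.h n j → Ore.Weyl.h n j ≤ Ore.Weyl.h n l →
        0 < α i j * α i l) :=
  ⟨fun _ hi he => hω.beta_pos hw hwv hi he,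
    fun _ _ _ hi hj hl hij hjl => hω.alpha_mul_alpha_pos hw hwv hα hi hj hl hij (hij.trans_le hjl)⟩
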